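/- Let $R$ be a complete, separated right linear topological ring (associative and unital), i.e. a topological ring in which the open right ideals $I$ form a base of neighborhoods of zero and the natural map $R\to\varprojlim_I R/I$ is bijective. For a set $X$, let $R[[X]]$ be the set of formal linear combinations $\sum_{x\in X} r_x x$ whose coefficients converge to zero: for every open right ideal $I$, $r_x\in I$ for all but finitely many $x$. The functor $X\mapsto R[[X]]$, with the point measures $X\to R[[X]]$ as unit and the opening of parentheses $R[[R[[X]]]]\to R[[X]]$ as multiplication, is a monad on the category of sets. A left $R$-contramodule is an algebra $(C,\pi_C\colon R[[C]]\to C)$ over this monad. Left $R$-contramodules form an abelian category with enough projective objects, in which projectivity and projective dimension are understood. A right $R$-module $N$ is discrete if the annihilator of each of its elements is an open right ideal of $R$. For a discrete right $R$-module $N$ and a left $R$-contramodule $P$, the contratensor product $N\odot_R P$ is the cokernel of the difference of the two maps $N\otimes_{\mathbb Z}R[[P]]\rightrightarrows N\otimes_{\mathbb Z}P$ given by $b\otimes u\mapsto b\otimes\pi_P(u)$ and by $b\otimes\sum_p r_pp\mapsto\sum_p br_p\otimes p$ (a finite sum, since $N$ is discrete). Let $\mathrm{Ctrtor}^R_i(N,-)$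 denote the left derived functors of $N\odot_R-$, computed by projective resolutions in the category of left $R$-contramodules. A left $R$-contramodule $F$ is $n$-strictly flat ($n\ge1$) if $\mathrm{Ctrtor}^R_i(N,F)=0$ for all discrete right $R$-modules $N$ and all $0<i\le n$; it is $\infty$-strictly flat if it is $n$-strictly flat for all $n\ge1$. A projective cover of $F$ is a morphism $p\colon P\to F$ with $P$ projective, through which every morphism from a projective object to $F$ factors, and such that every endomorphism $f$ of $P$ with $pf=p$ is an automorphism. **Theorem.** Let $F$ be an $\infty$-strictly flat left $R$-contramodule of projective dimension at most $1$. Assume that $F$ has a projective cover in the category of left $R$-contramodules. Then $F$ is a projective left $R$-contramodule. -/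

import Mathlib

open CategoryTheory CategoryTheory.Limits Topology

universe u

noncomputable section

set_option linter.unusedSectionVars false

/-! Throughout, `R` is a complete, separated right linear topological ring. Right ideals of `R` are
`Rᵐᵒᵖ`-submodules of `R`, and a right `R`-module is an `Rᵐᵒᵖ`-module, with `b r` written
`MulOpposite.op r • b`; `IsLinearTopology Rᵐᵒᵖ R` says that the open right ideals form a base of
neighborhoods of zero. -/

namespace Contra

section Summation

variable {R : Type u} [Ring R] [UniformSpace R] [IsUniformAddGroup R] [IsTopologicalRing R]
  [IsLinearTopology Rᵐᵒᵖ R]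

theorem nonarchimedean : NonarchimedeanAddGroup R where
  is_nonarchimedean U hU := by
    obtain ⟨I, hI, hIU⟩ := (IsLinearTopology.hasBasis_open_submodule Rᵐᵒᵖ (M := R)).mem_iff.mp hU
    exact ⟨⟨I.toAddSubgroup, hI⟩, hIU⟩

theorem tendsto_zero_iff {X : Type*} {r : X → R} :
    Filter.Tendsto r Filter.cofinite (𝓝 0) ↔
      ∀ I : Submodule Rᵐᵒᵖ R, IsOpen (I : Set R) → {x | r x ∉ I}.Finite := by
  rw [(IsLinearTopology.hasBasis_open_submodule Rᵐᵒᵖ (M := R)).tendsto_right_iff]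
  rfl

theorem summable_of_zero [CompleteSpace R] {X : Type*} {r : X → R}
    (h : ∀ I : Submodule Rᵐᵒᵖ R, IsOpen (I : Set R) → {x | r x ∉ I}.Finite) : Summable r :=
  haveI := nonarchimedean (R := R)
  NonarchimedeanAddGroup.summable_of_tendsto_cofinite_zero (tendsto_zero_iff.mpr h)

theorem exists_open_mul (I : Submodule Rᵐᵒᵖ R) (hI : IsOpen (I : Set R)) (a : R) :
    ∃ J : Submodule Rᵐᵒᵖ R, IsOpen (J : Set R) ∧ ∀ b ∈ J, a * b ∈ I := by
  have h : Filter.Tendsto (fun b : R => a * b) (𝓝 0) (𝓝 0) := by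
    simpa using (continuous_const_mul a).tendsto (0 : R)
  obtain ⟨J, hJ, hJI⟩ := (IsLinearTopology.hasBasis_open_submodule Rᵐᵒᵖ (M := R)).mem_iff.mp
    (h (hI.mem_nhds I.zero_mem))
  exact ⟨J, hJ, fun b hb => hJI hb⟩

theorem mul_mem (I : Submodule Rᵐᵒᵖ R) {a : R} (ha : a ∈ I) (b : R) : a * b ∈ I := by
  simpa using I.smul_mem (MulOpposite.op b) ha

theorem tsum_mem (I : Submodule Rᵐᵒᵖ R) (hI : IsOpen (I : Set R)) {X : Type*} {r : X → R}
    (h : ∀ x, r x ∈ I) : ∑' x, r x ∈ I :=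
  haveI : IsClosed (I : Set R) := I.toAddSubgroup.isClosed_of_isOpen hI
  _root_.tsum_mem (s := I) this h


variable [T2Space R] [CompleteSpace R]

theorem zero_mul_pair {X Y : Type*} {a : X → R} {b : X → Y → R}
    (ha : ∀ I : Submodule Rᵐᵒᵖ R, IsOpen (I : Set R) → {x | a x ∉ I}.Finite)
    (hb : ∀ x, ∀ I : Submodule Rᵐᵒᵖ R, IsOpen (I : Set R) → {y | b x y ∉ I}.Finite)
    (I : Submodule Rᵐᵒᵖ R) (hI : IsOpen (I : Set R)) :
    {p : X × Y | a p.1 * b p.1 p.2 ∉ I}.Finite := by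
  choose J hJ hJI using fun x => exists_open_mul I hI (a x)
  have hfin : (⋃ x ∈ {x | a x ∉ I}, (Prod.mk x) '' {y | b x y ∉ J x}).Finite :=
    (ha I hI).biUnion fun x _ => (hb x (J x) (hJ x)).image _
  refine hfin.subset ?_
  rintro ⟨x, y⟩ hxy
  simp only [Set.mem_iUnion]
  exact ⟨x, fun h => hxy (mul_mem I h _), y, fun h => hxy (hJI x _ h), rfl⟩

theorem tsum_assoc {X Y : Type*} {a : X → R} {b : X → Y → R} (c : Y → R)
    (ha : ∀ I : Submodule Rᵐᵒᵖ R, IsOpen (I : Set R) → {x | a x ∉ I}.Finite)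
    (hb : ∀ x, ∀ I : Submodule Rᵐᵒᵖ R, IsOpen (I : Set R) → {y | b x y ∉ I}.Finite) :
    ∑' y, (∑' x, a x * b x y) * c y = ∑' x, a x * ∑' y, b x y * c y := by
  have h1 : Summable fun p : X × Y => a p.1 * b p.1 p.2 * c p.2 :=
    summable_of_zero fun I hI => (zero_mul_pair ha hb I hI).subset fun p hp h =>
      hp (mul_mem I h _)
  have h2 : ∀ y, Summable fun x => a x * b x y := fun y =>
    summable_of_zero fun I hI => (ha I hI).subset fun x hx h => hx (mul_mem I h _)
  have h3 : ∀ x, Summable fun y => b x y * c y := fun x =>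
    summable_of_zero fun I hI => (hb x I hI).subset fun y hy h => hy (mul_mem I h _)
  calc ∑' y, (∑' x, a x * b x y) * c y = ∑' y, ∑' x, a x * b x y * c y :=
        tsum_congr fun y => ((h2 y).tsum_mul_right (c y)).symm
    _ = ∑' x, ∑' y, a x * b x y * c y :=
        (Summable.tsum_comm (f := fun x y => a x * b x y * c y) h1)
    _ = ∑' x, a x * ∑' y, b x y * c y := tsum_congr fun x => by
        rw [← (h3 x).tsum_mul_left (a x)]
        exact tsum_congr fun y => mul_assoc _ _ _

end Summation

section FormalSums

variable (R : Type u) [Ring R] [UniformSpace R] [IsUniformAddGroup R] [IsTopologicalRing R]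
  [IsLinearTopology Rᵐᵒᵖ R]

/-- The left `R`-module `R[[X]]` of `X`-indexed families of elements of `R` converging to zero:
for every open right ideal `I`, all but finitely many members of the family lie in `I`. -/
def zeroConvergent (X : Type u) : Submodule R (X → R) where
  carrier := {r | ∀ I : Submodule Rᵐᵒᵖ R, IsOpen (I : Set R) → {x | r x ∉ I}.Finite}
  add_mem' {r s} hr hs I hI := ((hr I hI).union (hs I hI)).subset fun x hx => by
    by_contra h
    simp only [Set.mem_union, Set.mem_ofPred_eq, not_or, not_not] at h
    exact hx (I.add_mem h.1 h.2)
  zero_mem' I _ := by simp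
  smul_mem' a r hr I hI := by
    obtain ⟨J, hJ, hJI⟩ := exists_open_mul I hI a
    exact (hr J hJ).subset fun x hx h => hx (hJI _ h)

/-- `R[[X]]`, the set of formal linear combinations `∑ r_x x` of elements of `X` with families of
coefficients converging to zero. -/
abbrev FormalSum (X : Type u) : Type u := zeroConvergent R X

variable {R}

theorem FormalSum.summable_mul [CompleteSpace R] {X : Type u} (u : FormalSum R X) (c : X → R) :
    Summable fun x => u.1 x * c x :=
  summable_of_zero fun I hI => (u.2 I hI).subset fun _ hx h => hx (mul_mem I h _)

namespace FormalSum

/-- `R[[f]] : R[[X]] → R[[Y]]`, taking `∑ r_x x` to the formal linear combination whose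
coefficient at `y` is the sum of `r_x` over all `x` with `f x = y`. -/
def map {X Y : Type u} (f : X → Y) (u : FormalSum R X) : FormalSum R Y :=
  ⟨fun y => ∑' x : {x : X // f x = y}, u.1 x.1, fun I hI =>
    ((u.2 I hI).image f).subset fun y hy => by
      by_contra h
      refine hy (tsum_mem I hI fun x => ?_)
      by_contra hx
      exact h ⟨x.1, hx, x.2⟩⟩

open Classical in
/-- The point measure `X → R[[X]]`. -/
def pure {X : Type u} (x : X) : FormalSum R X :=
  ⟨fun y => if y = x then 1 else 0, fun I _ => (Set.finite_singleton x).subset fun y hy => by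
    by_contra h
    refine hy ?_
    change (if y = x then (1 : R) else 0) ∈ I
    rw [if_neg (by simpa using h)]
    exact I.zero_mem⟩

variable [T2Space R] [CompleteSpace R]

/-- Substitution of the formal linear combinations `k x` for the elements `x` in `u`. -/
def bind {X Y : Type u} (u : FormalSum R X) (k : X → FormalSum R Y) : FormalSum R Y :=
  ⟨fun y => ∑' x, u.1 x * (k x).1 y, fun I hI =>
    ((zero_mul_pair u.2 (fun x => (k x).2) I hI).image Prod.snd).subset fun y hy => by
      by_contra h
      refine hy (tsum_mem I hI fun x => ?_)
      by_contra hx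
      exact h ⟨(x, y), hx, rfl⟩⟩

/-- Opening of parentheses `R[[R[[X]]]] → R[[X]]`: the coefficient of `∑ r_u u` at `x` is the sum
of the products `r_u * u_x`. -/
def join {X : Type u} (U : FormalSum R (FormalSum R X)) : FormalSum R X :=
  ⟨fun x => ∑' u : FormalSum R X, U.1 u * u.1 x, (bind U id).2⟩

theorem join_eq {X : Type u} (U : FormalSum R (FormalSum R X)) : join U = bind U id := rfl

theorem map_eq {X Y : Type u} (f : X → Y) (u : FormalSum R X) :
    map f u = bind u fun x => pure (f x) := by
  refine Subtype.ext (funext fun y => ?_)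
  refine (tsum_subtype {x | f x = y} u.1).trans (tsum_congr fun x => ?_)
  by_cases h : f x = y
  · rw [Set.indicator_of_mem (show x ∈ {x | f x = y} from h)]
    simp [pure, h]
  · rw [Set.indicator_of_notMem (show x ∉ {x | f x = y} from h)]
    simp [pure, Ne.symm h]

theorem bind_assoc {X Y Z : Type u} (u : FormalSum R X) (k : X → FormalSum R Y)
    (l : Y → FormalSum R Z) : bind (bind u k) l = bind u fun x => bind (k x) l :=
  Subtype.ext (funext fun z => tsum_assoc (fun y => (l y).1 z) u.2 fun x => (k x).2)

theorem pure_bind {X Y : Type u} (x : X) (k : X → FormalSum R Y) : bind (pure x) k = k x := by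
  refine Subtype.ext (funext fun y => ?_)
  refine (tsum_eq_single x fun x' hx' => ?_).trans ?_ <;> simp [pure, *]

theorem bind_pure {X : Type u} (u : FormalSum R X) : bind u pure = u := by
  refine Subtype.ext (funext fun y => ?_)
  refine (tsum_eq_single y fun x' hx' => ?_).trans ?_ <;> simp_all [pure, eq_comm]

theorem bind_add {X Y : Type u} (u v : FormalSum R X) (k : X → FormalSum R Y) :
    bind (u + v) k = bind u k + bind v k := by
  refine Subtype.ext (funext fun y => ?_)
  refine (tsum_congr fun x => ?_).trans
    ((u.summable_mul fun x => (k x).1 y).tsum_add (v.summable_mul fun x => (k x).1 y))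
  exact add_mul _ _ _

theorem bind_smul {X Y : Type u} (a : R) (u : FormalSum R X) (k : X → FormalSum R Y) :
    bind (a • u) k = a • bind u k := by
  refine Subtype.ext (funext fun y => ?_)
  refine (tsum_congr fun x => ?_).trans ((u.summable_mul fun x => (k x).1 y).tsum_mul_left a)
  exact mul_assoc _ _ _

theorem bind_add_right {X Y : Type u} (u : FormalSum R X) (k l : X → FormalSum R Y) :
    (bind u fun x => k x + l x) = bind u k + bind u l := by
  refine Subtype.ext (funext fun y => ?_)
  refine (tsum_congr fun x => ?_).trans
    ((u.summable_mul fun x => (k x).1 y).tsum_add (u.summable_mul fun x => (l x).1 y))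
  exact mul_add _ _ _

theorem map_pure {X Y : Type u} (f : X → Y) (x : X) :
    map f (pure x : FormalSum R X) = pure (f x) := by
  rw [map_eq, pure_bind]

theorem map_bind {X Y Z : Type u} (f : Y → Z) (u : FormalSum R X) (k : X → FormalSum R Y) :
    map f (bind u k) = bind u fun x => map f (k x) := by
  simp only [map_eq, bind_assoc]

theorem bind_map {X Y Z : Type u} (f : X → Y) (u : FormalSum R X) (k : Y → FormalSum R Z) :
    bind (map f u) k = bind u fun x => k (f x) := by
  simp only [map_eq, bind_assoc, pure_bind]

theorem map_map {X Y Z : Type u} (f : X → Y) (g : Y → Z) (u : FormalSum R X) :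
    map g (map f u) = map (fun x => g (f x)) u := by
  simp only [map_eq, bind_assoc, pure_bind]

theorem map_add {X Y : Type u} (f : X → Y) (u v : FormalSum R X) :
    map f (u + v) = map f u + map f v := by
  simp only [map_eq, bind_add]

theorem map_smul {X Y : Type u} (f : X → Y) (a : R) (u : FormalSum R X) :
    map f (a • u) = a • map f u := by
  simp only [map_eq, bind_smul]

end FormalSum

variable (R) [T2Space R] [CompleteSpace R]

/-- The monad `R[[-]]` on the category of sets. -/
def contraMonad : Monad (Type u) where
  obj X := FormalSum R X
  map f := ↾(FormalSum.map f)
  map_id X := by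
    ext u : 3
    exact (FormalSum.map_eq _ _).trans (FormalSum.bind_pure u)
  map_comp f g := by
    ext u : 3
    exact (FormalSum.map_map f g u).symm
  η := { app X := ↾FormalSum.pure
         naturality X Y f := by
          ext x : 3
          exact (FormalSum.map_pure f x).symm }
  μ := { app X := ↾FormalSum.join
         naturality X Y f := by
          ext U : 3
          exact (FormalSum.bind_map _ U id).trans (FormalSum.map_bind (X := FormalSum R X) f U id).symm }
  assoc X := by
    ext U : 3
    exact (FormalSum.bind_map _ U id).trans (FormalSum.bind_assoc U id id).symm
  left_unit X := by
    ext u : 3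
    exact FormalSum.pure_bind u id
  right_unit X := by
    ext u : 3
    exact (FormalSum.bind_map _ u id).trans (FormalSum.bind_pure u)

end FormalSums

section Category

variable (R : Type u) [Ring R] [UniformSpace R] [IsUniformAddGroup R] [IsTopologicalRing R]
  [IsLinearTopology Rᵐᵒᵖ R] [T2Space R] [CompleteSpace R]

/-- The category of left contramodules over `R`: algebras over the monad `R[[-]]`. -/
abbrev Contramodule : Type (u + 1) := (contraMonad R).Algebra

variable {R}

/-- The left contraaction map `R[[C]] → C`. -/
def act (C : Contramodule R) (u : FormalSum R C.A) : C.A := C.a u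

theorem act_pure (C : Contramodule R) (c : C.A) : act C (FormalSum.pure c) = c :=
  ConcreteCategory.congr_hom C.unit c

theorem act_join (C : Contramodule R) (U : FormalSum R (FormalSum R C.A)) :
    act C (FormalSum.join U) = act C (FormalSum.map (act C) U) :=
  ConcreteCategory.congr_hom C.assoc U

/-- The contramodule with a given contraaction map. -/
def mkContramodule (A : Type u) (a : FormalSum R A → A) (h1 : ∀ x, a (FormalSum.pure x) = x)
    (h2 : ∀ U, a (FormalSum.join U) = a (FormalSum.map a U)) : Contramodule R where
  A := A
  a := ↾a
  unit := by
    ext x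
    exact h1 x
  assoc := by
    ext U
    exact h2 U

/-- The contramodule morphism with a given underlying map. -/
def mkHom {C D : Contramodule R} (g : C.A → D.A)
    (h : ∀ u, g (act C u) = act D (FormalSum.map g u)) : C ⟶ D where
  f := ↾g
  h := by
    ext u
    exact (h u).symm

/-- The underlying map of a contramodule morphism. -/
def fn {C D : Contramodule R} (f : C ⟶ D) (c : C.A) : D.A := f.f c

theorem fn_act {C D : Contramodule R} (f : C ⟶ D) (u : FormalSum R C.A) :
    fn f (act C u) = act D (FormalSum.map (fn f) u) :=
  (ConcreteCategory.congr_hom f.h u).symm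

theorem hom_ext {C D : Contramodule R} {f g : C ⟶ D} (h : ∀ c, fn f c = fn g c) : f = g := by
  ext c
  exact h c

@[simp] theorem fn_mkHom {C D : Contramodule R} (g : C.A → D.A) (h) (c : C.A) :
    fn (mkHom (C := C) (D := D) g h) c = g c := rfl

@[simp] theorem fn_comp {C D E : Contramodule R} (f : C ⟶ D) (g : D ⟶ E) (c : C.A) :
    fn (f ≫ g) c = fn g (fn f c) := rfl

@[simp] theorem fn_id (C : Contramodule R) (c : C.A) : fn (𝟙 C) c = c := rfl

/-! The additive group of a contramodule: `c + d` is the value of the contraaction on the formal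
linear combination `1 c + 1 d`, and `r c` is its value on the formal linear combination `r c`. -/

instance instZero (C : Contramodule R) : Zero C.A := ⟨act C 0⟩
instance instAdd (C : Contramodule R) : Add C.A := ⟨fun c d => act C (FormalSum.pure c + FormalSum.pure d)⟩
instance instNeg (C : Contramodule R) : Neg C.A := ⟨fun c => act C (-FormalSum.pure c)⟩
instance instSub (C : Contramodule R) : Sub C.A := ⟨fun c d => act C (FormalSum.pure c - FormalSum.pure d)⟩
instance instSMulNat (C : Contramodule R) : SMul ℕ C.A := ⟨fun n c => act C (n • FormalSum.pure c)⟩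
instance instSMulInt (C : Contramodule R) : SMul ℤ C.A := ⟨fun n c => act C (n • FormalSum.pure c)⟩
instance instSMul (C : Contramodule R) : SMul R C.A := ⟨fun r c => act C (r • FormalSum.pure c)⟩

/-- Substitution of elements given by formal linear combinations. -/
theorem act_map_act (C : Contramodule R) {X : Type u} (u : FormalSum R X)
    (k : X → FormalSum R C.A) :
    act C (FormalSum.map (fun x => act C (k x)) u) = act C (FormalSum.bind u k) := by
  rw [← FormalSum.map_map k (act C), ← act_join, FormalSum.join_eq, FormalSum.bind_map]
  rfl

/-- Substitution as an `R`-linear map. -/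
def FormalSum.bindHom {X Y : Type u} (k : X → FormalSum R Y) :
    FormalSum R X →ₗ[R] FormalSum R Y where
  toFun u := FormalSum.bind u k
  map_add' u v := FormalSum.bind_add u v k
  map_smul' a u := FormalSum.bind_smul a u k

theorem act_bindHom (C : Contramodule R) (W : FormalSum R (FormalSum R C.A)) :
    act C (FormalSum.bindHom (fun u => FormalSum.pure (act C u)) W) =
      act C (FormalSum.bindHom id W) := by
  refine Eq.trans (congrArg (act C) ?_) (act_join C W).symm
  exact (FormalSum.map_eq _ _).symm

theorem bindHom_pure {X Y : Type u} (k : X → FormalSum R Y) (x : X) :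
    FormalSum.bindHom k (FormalSum.pure x) = k x := FormalSum.pure_bind x k

theorem act_zero (C : Contramodule R) : act C 0 = 0 := rfl

theorem act_add (C : Contramodule R) (u v : FormalSum R C.A) :
    act C (u + v) = act C u + act C v := by
  have h := act_bindHom C (FormalSum.pure u + FormalSum.pure v)
  simp only [map_add, bindHom_pure] at h
  exact h.symm

theorem act_neg (C : Contramodule R) (u : FormalSum R C.A) : act C (-u) = -act C u := by
  have h := act_bindHom C (-FormalSum.pure u)
  simp only [map_neg, bindHom_pure] at h
  exact h.symm

theorem act_sub (C : Contramodule R) (u v : FormalSum R C.A) :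
    act C (u - v) = act C u - act C v := by
  have h := act_bindHom C (FormalSum.pure u - FormalSum.pure v)
  simp only [map_sub, bindHom_pure] at h
  exact h.symm

theorem act_nsmul (C : Contramodule R) (u : FormalSum R C.A) (n : ℕ) :
    act C (n • u) = n • act C u := by
  have h := act_bindHom C (n • FormalSum.pure u)
  simp only [map_nsmul, bindHom_pure] at h
  exact h.symm

theorem act_zsmul (C : Contramodule R) (u : FormalSum R C.A) (n : ℤ) :
    act C (n • u) = n • act C u := by
  have h := act_bindHom C (n • FormalSum.pure u)
  simp only [map_zsmul, bindHom_pure] at h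
  exact h.symm

theorem act_smul (C : Contramodule R) (r : R) (u : FormalSum R C.A) :
    act C (r • u) = r • act C u := by
  have h := act_bindHom C (r • FormalSum.pure u)
  simp only [LinearMap.map_smul, bindHom_pure] at h
  exact h.symm

theorem act_surjective (C : Contramodule R) : Function.Surjective (act C) :=
  fun c => ⟨_, act_pure C c⟩

instance instAddCommGroup (C : Contramodule R) : AddCommGroup C.A :=
  (act_surjective C).addCommGroup (act C) (act_zero C) (act_add C) (act_neg C) (act_sub C)
    (act_nsmul C) (act_zsmul C)

/-- The contraaction as an additive map. -/
def actHom (C : Contramodule R) : FormalSum R C.A →+ C.A where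
  toFun := act C
  map_zero' := act_zero C
  map_add' := act_add C

/-- The underlying left `R`-module of a contramodule. -/
instance instModule (C : Contramodule R) : Module R C.A :=
  (act_surjective C).module R (actHom C) (act_smul C)

/-- A contramodule morphism is additive. -/
def fnHom {C D : Contramodule R} (f : C ⟶ D) : C.A →+ D.A :=
  AddMonoidHom.mk' (fn f) fun c d => by
    change fn f (act C _) = act D _
    rw [fn_act, FormalSum.map_add, FormalSum.map_pure, FormalSum.map_pure]

@[simp] theorem fnHom_apply {C D : Contramodule R} (f : C ⟶ D) (c : C.A) :
    fnHom f c = fn f c := rfl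

theorem act_map_add (C : Contramodule R) {X : Type u} (g h : X → C.A) (u : FormalSum R X) :
    act C (FormalSum.map (fun x => g x + h x) u) =
      act C (FormalSum.map g u) + act C (FormalSum.map h u) := by
  rw [← act_add, FormalSum.map_eq g, FormalSum.map_eq h, ← FormalSum.bind_add_right,
    ← act_map_act]
  rfl

/-- The additive map sending a family `g` to the infinite sum with coefficients `u`. -/
def actMapHom (C : Contramodule R) {X : Type u} (u : FormalSum R X) : (X → C.A) →+ C.A :=
  AddMonoidHom.mk' (fun g => act C (FormalSum.map g u)) fun g h => act_map_add C g h u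

theorem act_map_zero (C : Contramodule R) {X : Type u} (u : FormalSum R X) :
    act C (FormalSum.map (fun _ => (0 : C.A)) u) = 0 :=
  (actMapHom C u).map_zero

theorem act_map_neg (C : Contramodule R) {X : Type u} (g : X → C.A) (u : FormalSum R X) :
    act C (FormalSum.map (fun x => -g x) u) = -act C (FormalSum.map g u) :=
  (actMapHom C u).map_neg g

/-! The category of contramodules is preadditive, with pointwise addition of morphisms. -/

instance homZero (C D : Contramodule R) : Zero (C ⟶ D) :=
  ⟨mkHom (fun _ => 0) fun u => (act_map_zero D u).symm⟩

instance homAdd (C D : Contramodule R) : Add (C ⟶ D) :=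
  ⟨fun f g => mkHom (fun c => fn f c + fn g c) fun u => by
    rw [act_map_add, fn_act, fn_act]⟩

instance homNeg (C D : Contramodule R) : Neg (C ⟶ D) :=
  ⟨fun f => mkHom (fun c => -fn f c) fun u => by rw [act_map_neg, fn_act]⟩

@[simp] theorem fn_zero {C D : Contramodule R} (c : C.A) : fn (0 : C ⟶ D) c = 0 := rfl

@[simp] theorem fn_add {C D : Contramodule R} (f g : C ⟶ D) (c : C.A) :
    fn (f + g) c = fn f c + fn g c := rfl

@[simp] theorem fn_neg {C D : Contramodule R} (f : C ⟶ D) (c : C.A) : fn (-f) c = -fn f c := rfl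

instance homAddCommGroup (C D : Contramodule R) : AddCommGroup (C ⟶ D) where
  add_assoc f g h := hom_ext fun c => add_assoc _ _ _
  zero_add f := hom_ext fun c => zero_add _
  add_zero f := hom_ext fun c => add_zero _
  neg_add_cancel f := hom_ext fun c => neg_add_cancel _
  add_comm f g := hom_ext fun c => add_comm _ _
  nsmul := nsmulRec
  zsmul := zsmulRec

instance contramodulePreadditive : Preadditive (Contramodule R) where
  add_comp _ _ _ _ _ g := hom_ext fun _ => (fnHom g).map_add _ _
  comp_add _ _ _ _ _ _ := hom_ext fun _ => rfl

/-! Kernels and cokernels. -/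

theorem fn_act_ker {C D : Contramodule R} (f : C ⟶ D) (u : FormalSum R {c : C.A // fn f c = 0}) :
    fn f (act C (FormalSum.map Subtype.val u)) = 0 := by
  have h : (fun x : {c : C.A // fn f c = 0} => fn f x.1) = fun _ => 0 := funext fun x => x.2
  rw [fn_act, FormalSum.map_map, h]
  exact act_map_zero D u

/-- The kernel of a morphism. -/
def ker {C D : Contramodule R} (f : C ⟶ D) : Contramodule R :=
  mkContramodule {c : C.A // fn f c = 0}
    (fun u => ⟨act C (FormalSum.map Subtype.val u), fn_act_ker f u⟩)
    (fun x => Subtype.ext ((congrArg (act C) (FormalSum.map_pure _ x)).trans (act_pure C x.1)))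
    (fun U => Subtype.ext (by
      change act C (FormalSum.map Subtype.val (FormalSum.join U)) =
        act C (FormalSum.map Subtype.val (FormalSum.map _ U))
      rw [FormalSum.map_map, ← FormalSum.map_map (FormalSum.map Subtype.val) (act C), ← act_join,
        FormalSum.join_eq, FormalSum.join_eq, FormalSum.map_bind, FormalSum.bind_map]
      rfl))

/-- The inclusion of the kernel. -/
def kerHom {C D : Contramodule R} (f : C ⟶ D) : ker f ⟶ C :=
  mkHom (C := ker f) (fun c => c.1) fun _ => rfl

/-- Factorization through an injective morphism. -/
theorem exists_lift {C D E : Contramodule R} (f : C ⟶ D) (hf : Function.Injective (fn f))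
    (g : E ⟶ D) (h : ∀ e, ∃ c, fn f c = fn g e) : ∃ l : E ⟶ C, l ≫ f = g := by
  choose l hl using h
  refine ⟨mkHom l fun u => hf ?_, hom_ext hl⟩
  rw [hl, fn_act, fn_act, FormalSum.map_map]
  simp only [hl]

/-- Factorization through a surjective morphism. -/
theorem exists_desc {C D E : Contramodule R} (f : C ⟶ D) (hf : Function.Surjective (fn f))
    (g : C ⟶ E) (h : ∀ c, fn f c = 0 → fn g c = 0) : ∃ l : D ⟶ E, f ≫ l = g := by
  have h' : ∀ c c', fn f c = fn f c' → fn g c = fn g c' := fun c c' hc => by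
    have := h (c - c') (by rw [← fnHom_apply, map_sub, fnHom_apply, fnHom_apply, hc, sub_self])
    rwa [← fnHom_apply, map_sub, fnHom_apply, fnHom_apply, sub_eq_zero] at this
  choose s hs using hf
  have key : ∀ c, fn g (s (fn f c)) = fn g c := fun c => h' _ _ (hs _)
  refine ⟨mkHom (fun d => fn g (s d)) fun v => ?_, hom_ext key⟩
  rw [← FormalSum.map_map s (fn g), ← fn_act]
  refine h' _ _ ?_
  rw [hs, fn_act, FormalSum.map_map]
  simp only [hs]
  rw [FormalSum.map_eq, FormalSum.bind_pure]

theorem exists_isKernel {C D : Contramodule R} {K : Contramodule R} (i : K ⟶ C) (f : C ⟶ D)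
    (w : i ≫ f = 0) (hi : Function.Injective (fn i)) (h : ∀ c, fn f c = 0 → ∃ k, fn i k = c) :
    Nonempty (IsLimit (KernelFork.ofι i w)) := by
  have hl : ∀ {E : Contramodule R} (g : E ⟶ C), g ≫ f = 0 → ∃ l : E ⟶ K, l ≫ i = g :=
    fun g hg => exists_lift i hi g fun e => h _ (congrArg (fun t => fn t e) hg)
  choose l hl using @hl
  refine ⟨KernelFork.IsLimit.ofι i w (fun g hg => l g hg) (fun g hg => hl g hg)
    fun g hg m hm => hom_ext fun e => hi ?_⟩
  exact congrArg (fun t => fn t e) (hm.trans (hl g hg).symm)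

theorem exists_isCokernel {C D : Contramodule R} {Q : Contramodule R} (p : D ⟶ Q) (f : C ⟶ D)
    (w : f ≫ p = 0) (hp : Function.Surjective (fn p))
    (h : ∀ d, fn p d = 0 → ∃ c, fn f c = d) :
    Nonempty (IsColimit (CokernelCofork.ofπ p w)) := by
  have hl : ∀ {E : Contramodule R} (g : D ⟶ E), f ≫ g = 0 → ∃ l : Q ⟶ E, p ≫ l = g :=
    fun g hg => exists_desc p hp g fun d hd => by
      obtain ⟨c, rfl⟩ := h d hd
      exact congrArg (fun t => fn t c) hg
  choose l hl using @hl
  refine ⟨CokernelCofork.IsColimit.ofπ p w (fun g hg => l g hg) (fun g hg => hl g hg)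
    fun g hg m hm => hom_ext fun e => ?_⟩
  obtain ⟨d, rfl⟩ := hp e
  exact congrArg (fun t => fn t d) (hm.trans (hl g hg).symm)

theorem kerHom_comp {C D : Contramodule R} (f : C ⟶ D) : kerHom f ≫ f = 0 :=
  hom_ext fun c => c.2

theorem kerHom_injective {C D : Contramodule R} (f : C ⟶ D) : Function.Injective (fn (kerHom f)) :=
  Subtype.val_injective

theorem kerHom_isKernel {C D : Contramodule R} (f : C ⟶ D) :
    Nonempty (IsLimit (KernelFork.ofι (kerHom f) (kerHom_comp f))) :=
  exists_isKernel _ _ _ (kerHom_injective f) fun c hc => ⟨⟨c, hc⟩, rfl⟩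

/-- The contraaction on the cokernel. -/
def cokerAct {C D : Contramodule R} (f : C ⟶ D) (v : FormalSum R (D.A ⧸ (fnHom f).range)) :
    D.A ⧸ (fnHom f).range :=
  QuotientAddGroup.mk (act D (FormalSum.map Quotient.out v))

theorem cokerAct_map {C D : Contramodule R} (f : C ⟶ D) (u : FormalSum R D.A) :
    cokerAct f (FormalSum.map QuotientAddGroup.mk u) = QuotientAddGroup.mk (act D u) := by
  have h : ∀ d : D.A, ∃ c, d + fn f c =
      Quotient.out (QuotientAddGroup.mk d : D.A ⧸ (fnHom f).range) := fun d => by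
    obtain ⟨c, hc⟩ := QuotientAddGroup.eq.mp (QuotientAddGroup.out_eq'
      (QuotientAddGroup.mk d : D.A ⧸ (fnHom f).range)).symm
    exact ⟨c, by rw [← fnHom_apply, hc, add_neg_cancel_left]⟩
  choose c hc using h
  rw [cokerAct, FormalSum.map_map]
  simp only [← hc]
  rw [act_map_add, ← FormalSum.map_map c (fn f), ← fn_act, FormalSum.map_eq (fun d : D.A => d),
    FormalSum.bind_pure]
  refine (QuotientAddGroup.eq.mpr ?_).symm
  rw [neg_add_cancel_left]
  exact ⟨_, rfl⟩

theorem map_mk_out {C D : Contramodule R} (f : C ⟶ D)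
    (v : FormalSum R (D.A ⧸ (fnHom f).range)) :
    FormalSum.map QuotientAddGroup.mk (FormalSum.map Quotient.out v) = v := by
  rw [FormalSum.map_map]
  refine Eq.trans (FormalSum.map_eq _ _) (Eq.trans ?_ (FormalSum.bind_pure v))
  congr 1
  funext x
  exact congrArg _ (QuotientAddGroup.out_eq' x)

/-- The cokernel of a morphism. -/
def coker {C D : Contramodule R} (f : C ⟶ D) : Contramodule R :=
  mkContramodule (D.A ⧸ (fnHom f).range) (cokerAct f)
    (fun x => by
      rw [cokerAct, FormalSum.map_pure, act_pure]
      exact QuotientAddGroup.out_eq' x)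
    (fun V => by
      have hV : FormalSum.map (FormalSum.map QuotientAddGroup.mk)
          (FormalSum.map (FormalSum.map Quotient.out) V) = V := by
        rw [FormalSum.map_map]
        refine Eq.trans (FormalSum.map_eq _ _) (Eq.trans ?_ (FormalSum.bind_pure V))
        congr 1
        funext x
        exact congrArg _ (map_mk_out f x)
      rw [← hV]
      generalize FormalSum.map (FormalSum.map Quotient.out) V = U
      have hj : FormalSum.join (FormalSum.map (FormalSum.map QuotientAddGroup.mk) U) =
          FormalSum.map (QuotientAddGroup.mk (s := (fnHom f).range)) (FormalSum.join U) :=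
        (FormalSum.bind_map _ U id).trans
          (FormalSum.map_bind (X := FormalSum R D.A) _ U id).symm
      rw [hj, cokerAct_map, act_join, ← cokerAct_map, FormalSum.map_map, FormalSum.map_map]
      simp only [cokerAct_map])

/-- The projection to the cokernel. -/
def cokerHom {C D : Contramodule R} (f : C ⟶ D) : D ⟶ coker f :=
  mkHom (D := coker f) QuotientAddGroup.mk fun u => (cokerAct_map f u).symm

theorem cokerHom_surjective {C D : Contramodule R} (f : C ⟶ D) :
    Function.Surjective (fn (cokerHom f)) := QuotientAddGroup.mk_surjective

theorem cokerHom_eq_zero {C D : Contramodule R} (f : C ⟶ D) (d : D.A) :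
    fn (cokerHom f) d = 0 ↔ ∃ c, fn f c = d := by
  rw [← (fnHom (cokerHom f)).map_zero]
  refine (QuotientAddGroup.eq (s := (fnHom f).range)).trans ?_
  rw [add_zero, neg_mem_iff]
  rfl

theorem comp_cokerHom {C D : Contramodule R} (f : C ⟶ D) : f ≫ cokerHom f = 0 :=
  hom_ext fun c => (cokerHom_eq_zero f _).mpr ⟨c, rfl⟩

theorem cokerHom_isCokernel {C D : Contramodule R} (f : C ⟶ D) :
    Nonempty (IsColimit (CokernelCofork.ofπ (cokerHom f) (comp_cokerHom f))) :=
  exists_isCokernel _ _ _ (cokerHom_surjective f) fun d hd => (cokerHom_eq_zero f d).mp hd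

theorem injective_of_mono {C D : Contramodule R} (f : C ⟶ D) [Mono f] :
    Function.Injective (fn f) := by
  have h0 : kerHom f = 0 := zero_of_comp_mono f (kerHom_comp f)
  refine (injective_iff_map_eq_zero (fnHom f)).mpr fun c hc => ?_
  exact congrArg (fun t => fn t (⟨c, hc⟩ : {c : C.A // fn f c = 0})) h0

theorem surjective_of_epi {C D : Contramodule R} (f : C ⟶ D) [Epi f] :
    Function.Surjective (fn f) := fun d => by
  have h0 : cokerHom f = 0 := zero_of_epi_comp f (comp_cokerHom f)
  refine (cokerHom_eq_zero f d).mp ?_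
  rw [h0]
  rfl

/-- The category of left contramodules is abelian. -/
instance contramoduleAbelian : Abelian (Contramodule R) where
  has_finite_products := ⟨fun _ => ⟨fun D => Monad.hasLimit_of_comp_forget_hasLimit D⟩⟩
  has_kernels := ⟨fun f => ⟨⟨_, (kerHom_isKernel f).some⟩⟩⟩
  has_cokernels := ⟨fun f => ⟨⟨_, (cokerHom_isCokernel f).some⟩⟩⟩
  normalMonoOfMono f _ := ⟨⟨_, cokerHom f, comp_cokerHom f,
    (exists_isKernel f (cokerHom f) _ (injective_of_mono f)
      fun d hd => (cokerHom_eq_zero f d).mp hd).some⟩⟩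
  normalEpiOfEpi f _ := ⟨⟨_, kerHom f, kerHom_comp f,
    (exists_isCokernel f (kerHom f) _ (surjective_of_epi f) fun d hd => ⟨⟨d, hd⟩, rfl⟩).some⟩⟩

instance forgetPreservesEpi : (contraMonad R).forget.PreservesEpimorphisms where
  preserves f _ := (epi_iff_surjective _).mpr (surjective_of_epi f)

/-- There are enough projective contramodules: every contramodule `C` is a quotient of the free
contramodule `R[[C]]`. -/
instance contramoduleEnoughProjectives : EnoughProjectives (Contramodule R) where
  presentation C := ⟨{
    p := (contraMonad R).free.obj C.A
    projective := (contraMonad R).adj.map_projective C.A inferInstance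
    f := mkHom (C := (contraMonad R).free.obj C.A) (act C) fun U => act_join C U
    epi := by
      constructor
      intro Z g h hgh
      refine hom_ext fun c => ?_
      obtain ⟨u, rfl⟩ := act_surjective C c
      exact congrArg (fun t => fn t u) hgh }⟩

end Category

section Contratensor

open scoped TensorProduct

/-- A right `R`-module `N` is discrete if the annihilator `{r | b r = 0}` of every element `b` of
`N` is an open right ideal of `R`. -/
class IsDiscreteModule (R : Type*) [Ring R] [TopologicalSpace R] (N : Type*) [AddCommGroup N]
    [Module Rᵐᵒᵖ N] : Prop where
  isOpen_annihilator (b : N) : IsOpen {r : R | MulOpposite.op r • b = 0}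

variable {R : Type u} [Ring R] [UniformSpace R] [IsUniformAddGroup R] [IsTopologicalRing R]
  [IsLinearTopology Rᵐᵒᵖ R] {N : Type u} [AddCommGroup N] [Module Rᵐᵒᵖ N] [IsDiscreteModule R N]

/-- The annihilator of an element of a right module, a right ideal. -/
def ann (b : N) : Submodule Rᵐᵒᵖ R where
  carrier := {r : R | MulOpposite.op r • b = 0}
  add_mem' {r s} hr hs := by
    change MulOpposite.op (r + s) • b = 0
    rw [MulOpposite.op_add, add_smul, show MulOpposite.op r • b = 0 from hr,
      show MulOpposite.op s • b = 0 from hs, add_zero]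
  zero_mem' := by simp
  smul_mem' a r hr := by
    change MulOpposite.op (r * a.unop) • b = 0
    rw [MulOpposite.op_mul, mul_smul, show MulOpposite.op r • b = 0 from hr, smul_zero]

theorem isOpen_ann (b : N) : IsOpen (ann (R := R) b : Set R) :=
  IsDiscreteModule.isOpen_annihilator b

theorem mem_ann {b : N} {r : R} : r ∈ ann b ↔ MulOpposite.op r • b = 0 := Iff.rfl

/-- The finite formal linear combination `∑ (b r_x) x` in `N[X]`, for `b` in a discrete right
module `N` and `∑ r_x x` in `R[[X]]`. -/
def coeff {X : Type u} (b : N) (u : FormalSum R X) : X →₀ N :=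
  Finsupp.ofSupportFinite (fun x => MulOpposite.op (u.1 x) • b) (u.2 (ann b) (isOpen_ann b))

theorem coeff_apply {X : Type u} (b : N) (u : FormalSum R X) (x : X) :
    coeff b u x = MulOpposite.op (u.1 x) • b := rfl

theorem coeff_add_left {X : Type u} (b c : N) (u : FormalSum R X) :
    coeff (b + c) u = coeff b u + coeff c u := by
  ext x
  simp [coeff_apply]

theorem coeff_add_right {X : Type u} (b : N) (u v : FormalSum R X) :
    coeff b (u + v) = coeff b u + coeff b v := by
  ext x
  simp [coeff_apply, add_smul]

variable [T2Space R] [CompleteSpace R]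

theorem coeff_map {X Y : Type u} (f : X → Y) (b : N) (u : FormalSum R X) :
    coeff b (FormalSum.map f u) = (coeff b u).mapDomain f := by
  classical
  ext y
  have hs : Summable fun x => if f x = y then u.1 x else 0 :=
    summable_of_zero fun I hI => (u.2 I hI).subset fun x hx h => hx (by
      split_ifs
      · exact h
      · exact I.zero_mem)
  have h1 : (FormalSum.map f u).1 y = ∑' x, if f x = y then u.1 x else 0 := by
    refine (tsum_subtype {x | f x = y} u.1).trans (tsum_congr fun x => ?_)
    simp [Set.indicator]
  have h2 : (∑' x, if f x = y then u.1 x else 0) -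
      ∑ x ∈ (coeff b u).support, (if f x = y then u.1 x else 0) ∈ ann b := by
    rw [← hs.sum_add_tsum_compl (s := (coeff b u).support), add_sub_cancel_left]
    refine tsum_mem _ (isOpen_ann b) fun x => ?_
    have hx : u.1 x.1 ∈ ann b := by
      by_contra h
      exact x.2 (Finset.mem_coe.mpr (Finsupp.mem_support_iff.mpr h))
    split_ifs
    · exact hx
    · exact (ann b).zero_mem
  rw [coeff_apply, h1, Finsupp.mapDomain, Finsupp.sum_apply, Finsupp.sum]
  rw [mem_ann, MulOpposite.op_sub, sub_smul, sub_eq_zero] at h2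
  rw [h2, ← MulOpposite.opAddEquiv_apply, map_sum, Finset.sum_smul]
  refine Finset.sum_congr rfl fun x _ => ?_
  rw [Finsupp.single_apply]
  split_ifs <;> simp [coeff_apply, MulOpposite.opAddEquiv_apply]

variable (N)

/-- The map `N ⊗ R[[P]] → N ⊗ P` induced by the contraaction. -/
def contraMap (P : Contramodule R) : N ⊗[ℤ] FormalSum R P.A →+ N ⊗[ℤ] P.A :=
  ((actHom P).toIntLinearMap.lTensor N).toAddMonoidHom

/-- The map `N ⊗ R[[P]] → N ⊗ P` taking `b ⊗ ∑ r_p p` to `∑ b r_p ⊗ p`. -/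
def discreteMap (P : Contramodule R) : N ⊗[ℤ] FormalSum R P.A →+ N ⊗[ℤ] P.A :=
  TensorProduct.liftAddHom
    (AddMonoidHom.mk' (fun b => AddMonoidHom.mk'
        (fun u : FormalSum R P.A => (coeff b u).sum fun p n => n ⊗ₜ[ℤ] p)
        fun u v => by
          rw [coeff_add_right]
          exact Finsupp.sum_add_index' (fun p => TensorProduct.zero_tmul _ p)
            fun p n n' => TensorProduct.add_tmul n n' p)
      fun b c => AddMonoidHom.ext fun u => by
        change (coeff (b + c) u).sum (fun p n => n ⊗ₜ[ℤ] p) =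
          (coeff b u).sum (fun p n => n ⊗ₜ[ℤ] p) + (coeff c u).sum fun p n => n ⊗ₜ[ℤ] p
        rw [coeff_add_left]
        exact Finsupp.sum_add_index' (fun p => TensorProduct.zero_tmul _ p)
          fun p n n' => TensorProduct.add_tmul n n' p)
    fun r b u => by
      rw [map_zsmul, map_zsmul]
      rfl

theorem contraMap_tmul (P : Contramodule R) (b : N) (u : FormalSum R P.A) :
    contraMap N P (b ⊗ₜ u) = b ⊗ₜ act P u := rfl

theorem discreteMap_tmul (P : Contramodule R) (b : N) (u : FormalSum R P.A) :
    discreteMap N P (b ⊗ₜ u) = (coeff b u).sum fun p n => n ⊗ₜ[ℤ] p := rfl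

/-- The contratensor product of `N` and `P`: the cokernel of the difference of the two maps
`N ⊗ R[[P]] → N ⊗ P`. -/
abbrev ContratensorProduct (P : Contramodule R) : Type u :=
  (N ⊗[ℤ] P.A) ⧸ (contraMap N P - discreteMap N P).range

/-- The map `N ⊗ P → N ⊗ Q` induced by a morphism `P → Q`. -/
def tensorHom {P Q : Contramodule R} (f : P ⟶ Q) : N ⊗[ℤ] P.A →+ N ⊗[ℤ] Q.A :=
  ((fnHom f).toIntLinearMap.lTensor N).toAddMonoidHom

theorem tensorHom_tmul {P Q : Contramodule R} (f : P ⟶ Q) (b : N) (p : P.A) :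
    tensorHom N f (b ⊗ₜ p) = b ⊗ₜ fn f p := rfl

theorem tensorHom_range {P Q : Contramodule R} (f : P ⟶ Q) :
    (contraMap N P - discreteMap N P).range ≤
      (contraMap N Q - discreteMap N Q).range.comap (tensorHom N f) := by
  rintro _ ⟨t, rfl⟩
  induction t with
  | zero => rw [map_zero]; exact zero_mem _
  | add x y hx hy => rw [map_add]; exact add_mem hx hy
  | tmul b u =>
    refine ⟨b ⊗ₜ FormalSum.map (fn f) u, ?_⟩
    rw [AddMonoidHom.sub_apply, AddMonoidHom.sub_apply, map_sub, contraMap_tmul, contraMap_tmul,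
      discreteMap_tmul, discreteMap_tmul, tensorHom_tmul, fn_act, coeff_map,
      Finsupp.sum_mapDomain_index (fun p => TensorProduct.zero_tmul _ p)
        fun p n n' => TensorProduct.add_tmul n n' p, map_finsuppSum]
    rfl

/-- The functor of contratensor product with a discrete right module `N`. -/
def contratensor : Contramodule R ⥤ AddCommGrpCat.{u} where
  obj P := AddCommGrpCat.of (ContratensorProduct N P)
  map f := AddCommGrpCat.ofHom (QuotientAddGroup.map _ _ (tensorHom N f) (tensorHom_range N f))
  map_id P := by
    ext t
    refine congrArg QuotientAddGroup.mk ?_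
    exact DFunLike.congr_fun (LinearMap.lTensor_id N P.A) t
  map_comp f g := by
    ext t
    refine congrArg QuotientAddGroup.mk ?_
    exact DFunLike.congr_fun (LinearMap.lTensor_comp N (fnHom g).toIntLinearMap
      (fnHom f).toIntLinearMap) t

instance contratensorAdditive : (contratensor (R := R) N).Additive where
  map_add {P Q f g} := by
    have h : tensorHom N (f + g) = tensorHom N f + tensorHom N g :=
      AddMonoidHom.ext fun t => DFunLike.congr_fun (LinearMap.lTensor_add N
        (fnHom f).toIntLinearMap (fnHom g).toIntLinearMap) t
    ext x
    obtain ⟨t, rfl⟩ := QuotientAddGroup.mk_surjective x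
    change (QuotientAddGroup.mk (tensorHom N (f + g) t) : ContratensorProduct N Q) =
      QuotientAddGroup.mk (tensorHom N f t) + QuotientAddGroup.mk (tensorHom N g t)
    rw [h]
    rfl

/-- The left derived functors `Ctrtor_i(N, -)` of contratensor product, constructed by means of
projective resolutions of the contramodule argument. -/
def ctrtor (i : ℕ) : Contramodule R ⥤ AddCommGrpCat.{u} := (contratensor N).leftDerived i

variable {N}

/-- A contramodule `F` is `n`-strictly flat if `Ctrtor_i(N, F) = 0` for all discrete right
modules `N` and all `0 < i ≤ n`. -/
def IsStrictlyFlat (n : ℕ) (F : Contramodule R) : Prop :=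
  ∀ (N : Type u) [AddCommGroup N] [Module Rᵐᵒᵖ N] [IsDiscreteModule R N] (i : ℕ),
    0 < i → i ≤ n → IsZero ((ctrtor N i).obj F)

/-- A contramodule is `∞`-strictly flat if it is `n`-strictly flat for all `n ≥ 1`. -/
def IsInftyStrictlyFlat (F : Contramodule R) : Prop := ∀ n : ℕ, 1 ≤ n → IsStrictlyFlat n F

end Contratensor

section Covers

variable {C : Type*} [Category C]

/-- A morphism `l : L ⟶ A` is an `S`-precover of `A` if `L` is in `S` and every morphism to `A`
from an object in `S` factors through `l`. -/
def IsPrecover (S : ObjectProperty C) {L A : C} (l : L ⟶ A) : Prop :=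
  S L ∧ ∀ (L' : C) (l' : L' ⟶ A), S L' → ∃ f : L' ⟶ L, f ≫ l = l'

/-- An `S`-precover `l : L ⟶ A` is an `S`-cover if every endomorphism `f` of `L` with `l f = l`
is an automorphism. -/
def IsCover (S : ObjectProperty C) {L A : C} (l : L ⟶ A) : Prop :=
  IsPrecover S l ∧ ∀ f : L ⟶ L, f ≫ l = l → IsIso f

/-- The object `A` has a projective cover. -/
def HasProjectiveCover (A : C) : Prop :=
  ∃ (P : C) (p : P ⟶ A), IsCover (isProjective C) p

end Covers

end Contra

end

/-!
Let `p : P ⟶ F` be a projective cover, with kernel `K`. Since `F` has projective dimension at most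
one, `K` is projective, and the claim is that `K = 0`.

Write `P` as a direct summand of `R[[P]]`, so that its elements have coordinates in `R`. For `k` in
`K`, a coordinate `a` of `k` and `b` in `R`, subtracting from `q` in `P` the multiple of `b k` by the
corresponding coordinate of `q` is an endomorphism of `P` over `F`, hence an automorphism. It follows
that `1 - a b` is right invertible (`Contra.right_quasiregular_of_mem_ker`), so that `a` kills all
simple right `R`-modules `N`. If `N` is moreover discrete, then `n ⊗ k` is equal to the sum of the
`n a ⊗ x` over the coordinates `a` of `k`, and the map `N ⊙ K ⟶ N ⊙ P` is therefore zero. On the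
other hand it is injective, because the first derived functor `Ctrtor_1(N, F)` vanishes
(`mono_map_of_isZero_leftDerived_one`). Hence `N ⊙ K = 0` for every simple discrete `N`.

A projective contramodule `K` with this property is zero. Indeed, `K` is the image of an idempotent
matrix whose entries kill all simple discrete right modules, and an argument in the style of
Nakayama's lemma, carried out modulo each open right ideal of `R`, shows that a row fixed by such a
matrix vanishes (`Contra.eq_zero_of_row_fixed`).
-/

/-! ### Derived functors of short exact sequences -/

section DerivedFunctor

/-- If `0 ⟶ X₁ ⟶ X₂ ⟶ X₃ ⟶ 0` is a projective resolution of `X₃` of length one and `L₁T` vanishes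
on `X₃`, then `T` carries `X₁ ⟶ X₂` to a monomorphism. The two-term resolution is compared by hand
with the chosen resolution of `X₃`. -/
theorem mono_map_of_isZero_leftDerived_one {C D : Type*} [Category C] [Abelian C]
    [HasProjectiveResolutions C] [Category D] [Abelian D] (T : C ⥤ D) [T.Additive]
    {S : ShortComplex C} (hS : S.ShortExact) [Projective S.X₁] [Projective S.X₂]
    (h0 : IsZero ((T.leftDerived 1).obj S.X₃)) : Mono (T.map S.f) := by
  have := hS.mono_f
  have := hS.epi_g
  let Q := projectiveResolution S.X₃
  let d : Q.complex.X 1 ⟶ Q.complex.X 0 := Q.complex.d 1 0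
  let d' : Q.complex.X 2 ⟶ Q.complex.X 1 := Q.complex.d 2 1
  let ε : Q.complex.X 0 ⟶ S.X₃ := Q.π.f 0
  have hε : Epi ε := inferInstanceAs (Epi (Q.π.f 0))
  have hdε : d ≫ ε = 0 := Q.complex_d_comp_π_f_zero
  have hd'd : d' ≫ d = 0 := Q.complex.d_comp_d 2 1 0
  have hex : (ShortComplex.mk d ε hdε).Exact :=
    ShortComplex.exact_of_g_is_cokernel _ Q.isColimitCokernelCofork
  have hT : (ShortComplex.mk (T.map d') (T.map d)
      (by rw [← T.map_comp, hd'd, T.map_zero])).Exact := by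
    have h1 := h0.of_iso (Q.isoLeftDerivedObj T 1).symm
    rw [HomologicalComplex.homologyFunctor_obj,
      ← HomologicalComplex.exactAt_iff_isZero_homology,
      HomologicalComplex.exactAt_iff' _ 2 1 0 (by simp) (by simp)] at h1
    exact h1
  -- `α`, `l` and `β`, `μ` are the comparison maps of the two resolutions; `ρ` is the homotopy
  -- between `α ≫ β` and the identity.
  obtain ⟨α, hα⟩ : ∃ α : S.X₂ ⟶ Q.complex.X 0, α ≫ ε = S.g :=
    ⟨Projective.factorThru S.g ε, Projective.factorThru_comp _ _⟩
  obtain ⟨β, hβ⟩ : ∃ β : Q.complex.X 0 ⟶ S.X₂, β ≫ S.g = ε :=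
    ⟨Projective.factorThru ε S.g, Projective.factorThru_comp _ _⟩
  obtain ⟨ρ, hρ⟩ : ∃ ρ : S.X₂ ⟶ S.X₁, ρ ≫ S.f = α ≫ β - 𝟙 _ :=
    ⟨hS.exact.lift (α ≫ β - 𝟙 _) (by simp [hα, hβ]), hS.exact.lift_f _ _⟩
  obtain ⟨μ, hμ⟩ : ∃ μ : Q.complex.X 1 ⟶ S.X₁, μ ≫ S.f = d ≫ β :=
    ⟨hS.exact.lift (d ≫ β) (by simp [hβ, hdε]), hS.exact.lift_f _ _⟩
  obtain ⟨l, hl⟩ : ∃ l : S.X₁ ⟶ Q.complex.X 1, l ≫ d = S.f ≫ α :=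
    ⟨hex.liftFromProjective (S.f ≫ α) (by simp [hα]), hex.liftFromProjective_comp _ _⟩
  have hlμ : l ≫ μ = 𝟙 _ + S.f ≫ ρ := by
    rw [← cancel_mono S.f]
    simp only [Category.assoc, Preadditive.add_comp, hμ, hρ, reassoc_of% hl]
    simp
  have hd'μ : d' ≫ μ = 0 := by
    rw [← cancel_mono S.f, Category.assoc, hμ, reassoc_of% hd'd, zero_comp, zero_comp]
  -- A map `t` into `T X₁` killed by `T S.f` satisfies `t ≫ T l ≫ T μ = t` by `hlμ`, while
  -- `t ≫ T l` is a cycle, hence locally a boundary, and `T μ` kills boundaries.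
  refine Preadditive.mono_of_cancel_zero _ fun {A} t ht => ?_
  obtain ⟨A', e, _, w, hw⟩ := hT.exact_up_to_refinements (t ≫ T.map l) (by
    simp only [Category.assoc, ← T.map_comp, hl]
    rw [T.map_comp, reassoc_of% ht, zero_comp])
  have key : (t ≫ T.map l) ≫ T.map μ = t := by
    rw [Category.assoc, ← T.map_comp, hlμ, T.map_add, T.map_comp, Preadditive.comp_add,
      reassoc_of% ht, T.map_id, zero_comp, add_zero, Category.comp_id]
  rw [← cancel_epi e, comp_zero, ← key, ← Category.assoc, hw, Category.assoc]
  dsimp only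
  rw [← T.map_comp, hd'μ, T.map_zero, comp_zero]

end DerivedFunctor

namespace Contra

/-! ### Simple discrete right modules -/

section SimpleModules

/-- An element `a` with `1 - a b` right invertible for every `b` kills every simple right module. It
is enough to write `a = (1 - a b) c`, since then `(1 - a b) (1 + c b) = 1`. -/
theorem smul_eq_zero_of_right_quasiregular {R : Type*} [Ring R] {N : Type*} [AddCommGroup N]
    [Module Rᵐᵒᵖ N] [IsSimpleModule Rᵐᵒᵖ N] {a : R} (ha : ∀ b : R, ∃ c, (1 - a * b) * c = a)
    (n : N) : MulOpposite.op a • n = 0 := by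
  by_contra hn
  obtain ⟨b, hb⟩ := IsSimpleModule.toSpanSingleton_surjective Rᵐᵒᵖ hn n
  obtain ⟨c, hc⟩ := ha b.unop
  apply hn
  rw [← hc, MulOpposite.op_mul, mul_smul, MulOpposite.op_sub, sub_smul, MulOpposite.op_mul,
    mul_smul]
  rw [LinearMap.toSpanSingleton_apply] at hb
  simp [hb]

theorem isDiscreteModule_quotient {R : Type u} [Ring R] [TopologicalSpace R]
    [IsTopologicalRing R] (I : Submodule Rᵐᵒᵖ R) (hI : IsOpen (I : Set R)) :
    IsDiscreteModule R (R ⧸ I) where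
  isOpen_annihilator b := by
    obtain ⟨a, rfl⟩ := Submodule.Quotient.mk_surjective I b
    have : {r : R | MulOpposite.op r • (Submodule.Quotient.mk a : R ⧸ I) = 0} =
        (a * ·) ⁻¹' (I : Set R) := by
      ext r
      rw [Set.mem_ofPred_eq, ← Submodule.Quotient.mk_smul, Submodule.Quotient.mk_eq_zero]
      rfl
    rw [this]
    exact hI.preimage (continuous_const_mul a)

theorem IsDiscreteModule.of_injective {R : Type u} [Ring R] [TopologicalSpace R] {N N' : Type u}
    [AddCommGroup N] [Module Rᵐᵒᵖ N] [AddCommGroup N'] [Module Rᵐᵒᵖ N'] [IsDiscreteModule R N']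
    (f : N →ₗ[Rᵐᵒᵖ] N') (hf : Function.Injective f) : IsDiscreteModule R N where
  isOpen_annihilator b := by
    have h : {r : R | MulOpposite.op r • b = 0} = {r : R | MulOpposite.op r • f b = 0} := by
      ext r
      rw [Set.mem_ofPred_eq, Set.mem_ofPred_eq, ← map_smul, map_eq_zero_iff f hf]
    exact h ▸ IsDiscreteModule.isOpen_annihilator (f b)

variable {R : Type u} [Ring R] [UniformSpace R] [IsUniformAddGroup R] [IsTopologicalRing R]
  [IsLinearTopology Rᵐᵒᵖ R]

theorem IsDiscreteModule.of_surjective {N N' : Type u} [AddCommGroup N] [Module Rᵐᵒᵖ N]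
    [AddCommGroup N'] [Module Rᵐᵒᵖ N'] [IsDiscreteModule R N] (f : N →ₗ[Rᵐᵒᵖ] N')
    (hf : Function.Surjective f) : IsDiscreteModule R N' where
  isOpen_annihilator b := by
    obtain ⟨b, rfl⟩ := hf b
    exact AddSubgroup.isOpen_mono (H₁ := (ann (R := R) b).toAddSubgroup)
      (H₂ := ((LinearMap.toSpanSingleton Rᵐᵒᵖ N' (f b)).toAddMonoidHom.comp
        (MulOpposite.opAddEquiv (α := R)).toAddMonoidHom).ker)
      (fun r hr => (f.map_smul _ b).symm.trans ((congrArg f (mem_ann.mp hr)).trans f.map_zero))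
      (IsDiscreteModule.isOpen_annihilator b)

/-- A form of Nakayama's lemma: a zero-convergent row `v` with `v e = v`, where the entries of the
row-zero-convergent matrix `e` kill all simple discrete right modules, is zero. Modulo an open right
ideal `I` only finitely many entries of `v` survive; they generate a discrete right module `M`
without maximal submodules, so that `M = 0`. -/
theorem eq_zero_of_row_fixed [T2Space R] [CompleteSpace R] {X : Type u} (v : FormalSum R X)
    (e : X → FormalSum R X) (hv : FormalSum.bind v e = v)
    (he : ∀ (N : Type u) [AddCommGroup N] [Module Rᵐᵒᵖ N] [IsDiscreteModule R N]
      [IsSimpleModule Rᵐᵒᵖ N] (n : N) (y z : X), MulOpposite.op ((e y).1 z) • n = 0) :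
    v = 0 := by
  have hmem : ∀ I : Submodule Rᵐᵒᵖ R, IsOpen (I : Set R) → ∀ z, v.1 z ∈ I := by
    intro I hI
    have := isDiscreteModule_quotient I hI
    let q : X → R ⧸ I := fun z => Submodule.Quotient.mk (v.1 z)
    let S : Finset X := (v.2 I hI).toFinset
    have hS : ∀ y ∉ S, q y = 0 := fun y hy => by
      simpa [S, q, Submodule.Quotient.mk_eq_zero] using hy
    have hq : ∀ z, q z = ∑ y ∈ S, MulOpposite.op ((e y).1 z) • q y := fun z => by
      have h1 : v.1 z - ∑ y ∈ S, v.1 y * (e y).1 z ∈ I := by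
        have h2 : v.1 z = ∑' y, v.1 y * (e y).1 z := congrArg (fun w => w.1 z) hv.symm
        rw [h2, ← (v.summable_mul fun y => (e y).1 z).sum_add_tsum_compl (s := S),
          add_sub_cancel_left]
        refine tsum_mem I hI fun y => mul_mem I ?_ _
        by_contra h
        exact y.2 (by simpa [S] using h)
      rw [← Submodule.Quotient.mk_eq_zero, Submodule.Quotient.mk_sub, sub_eq_zero] at h1
      refine h1.trans ?_
      rw [← Submodule.mkQ_apply, map_sum]
      rfl
    let M : Submodule Rᵐᵒᵖ (R ⧸ I) := Submodule.span Rᵐᵒᵖ (q '' S)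
    have : Module.Finite Rᵐᵒᵖ M := Module.Finite.span_of_finite Rᵐᵒᵖ (S.finite_toSet.image q)
    have hqM : ∀ z, q z ∈ M := fun z => by
      by_cases hz : z ∈ S
      · exact Submodule.subset_span ⟨z, hz, rfl⟩
      · rw [hS z hz]
        exact M.zero_mem
    -- Otherwise `M` has a simple discrete quotient, in which every generator vanishes by `hq`.
    have hbot : (⊥ : Submodule Rᵐᵒᵖ M) = ⊤ := by
      rcases eq_top_or_exists_le_coatom (⊥ : Submodule Rᵐᵒᵖ M) with h | ⟨m, hm, -⟩
      · exact h
      · exfalso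
        have : IsSimpleModule Rᵐᵒᵖ (M ⧸ m) := isSimpleModule_iff_isCoatom.mpr hm
        have : IsDiscreteModule R M := .of_injective M.subtype M.injective_subtype
        have : IsDiscreteModule R (M ⧸ m) := .of_surjective m.mkQ m.mkQ_surjective
        refine hm.1 (eq_top_iff.mpr ?_)
        have hle : M ≤ m.map M.subtype := Submodule.span_le.mpr (by
          rintro _ ⟨z, -, rfl⟩
          refine ⟨⟨q z, hqM z⟩, ?_, rfl⟩
          have h3 : (⟨q z, hqM z⟩ : M) =
              ∑ y ∈ S, MulOpposite.op ((e y).1 z) • (⟨q y, hqM y⟩ : M) :=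
            Subtype.ext (by simpa using hq z)
          rw [SetLike.mem_coe, ← m.ker_mkQ, LinearMap.mem_ker, h3, map_sum]
          exact Finset.sum_eq_zero fun y _ => by rw [map_smul, he])
        intro x _
        obtain ⟨x', hx', h⟩ := hle x.2
        rwa [← Subtype.ext h]
    have hM : M = ⊥ := by
      rw [← Submodule.subsingleton_iff_eq_bot, ← Submodule.subsingleton_iff Rᵐᵒᵖ]
      exact subsingleton_of_bot_eq_top hbot
    intro z
    have := hqM z
    rw [hM] at this
    exact (Submodule.Quotient.mk_eq_zero I).mp this
  refine Subtype.ext (funext fun z => ?_)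
  by_contra hz
  obtain ⟨I, hI, hIz⟩ := (IsLinearTopology.hasBasis_open_submodule Rᵐᵒᵖ (M := R)).mem_iff.mp
    (isOpen_compl_singleton.mem_nhds (show (0 : R) ∈ ({v.1 z}ᶜ : Set R) from Ne.symm hz))
  exact hIz (hmem I hI z) rfl

end SimpleModules

variable {R : Type u} [Ring R] [UniformSpace R] [IsUniformAddGroup R] [IsTopologicalRing R]
  [IsLinearTopology Rᵐᵒᵖ R] [T2Space R] [CompleteSpace R]

/-! ### Projective contramodules as direct summands of free ones -/

section ProjectiveContramodules

theorem fn_smul {C D : Contramodule R} (f : C ⟶ D) (r : R) (c : C.A) :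
    fn f (r • c) = r • fn f c := by
  change fn f (act C _) = act D _
  rw [fn_act, FormalSum.map_smul, FormalSum.map_pure]

/-- A projective contramodule `P` is a direct summand of `R[[P]]`: the contraaction has a section
`σ : P → R[[P]]` which is a morphism of contramodules, the latter property being expressed by
`σ (act P u) = FormalSum.bind u σ`. The coefficients of `σ c` serve as coordinates of `c`. -/
theorem exists_section_of_projective (P : Contramodule R) [Projective P] :
    ∃ σ : P.A → FormalSum R P.A, (∀ c, act P (σ c) = c) ∧
      ∀ u, σ (act P u) = FormalSum.bind u σ := by
  let π : (contraMonad R).free.obj P.A ⟶ P :=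
    mkHom (C := (contraMonad R).free.obj P.A) (act P) fun U => act_join P U
  have : Epi π := by
    constructor
    intro Z g h hgh
    refine hom_ext fun c => ?_
    obtain ⟨u, rfl⟩ := act_surjective P c
    exact congrArg (fun t => fn t u) hgh
  let s := Projective.factorThru (𝟙 P) π
  refine ⟨fn s, fun c => ?_, fun u => ?_⟩
  · exact congrArg (fun t => fn t c) (Projective.factorThru_comp (𝟙 P) π)
  · rw [fn_act]
    exact FormalSum.bind_map (Z := P.A) (fn s) u id

theorem section_smul {P : Contramodule R} {σ : P.A → FormalSum R P.A}
    (hσ : ∀ u, σ (act P u) = FormalSum.bind u σ) (r : R) (c : P.A) :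
    σ (r • c) = r • σ c := by
  refine (hσ _).trans ?_
  rw [FormalSum.bind_smul, FormalSum.pure_bind]

open Classical in
theorem act_map_ite (P : Contramodule R) {X : Type u} (x : X) (d : P.A) (u : FormalSum R X) :
    act P (FormalSum.map (fun y => if y = x then d else 0) u) = u.1 x • d := by
  have h1 : (fun y => if y = x then d else 0) =
      fun y => act P (if y = x then FormalSum.pure d else 0) := by
    funext y
    split_ifs
    · exact (act_pure P d).symm
    · rfl
  rw [h1, act_map_act]
  refine congrArg (act P) (Subtype.ext (funext fun z => ?_))
  refine (tsum_eq_single x fun y hy => ?_).trans ?_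
  · simp [hy]
  · simp

end ProjectiveContramodules

/-! ### The kernel of a projective cover -/

section Covers

/-- The coordinates `a` of an element `k` of the kernel of a projective cover `p : P ⟶ F` have the
property that `1 - a b` is right invertible for every `b`. The endomorphism
`q ↦ q - q_x b k` of `P`, where `q_x` is the coordinate of `q` at `x`, commutes with `p`, hence is
invertible; it takes `k` to `(1 - a b) k`. -/
theorem right_quasiregular_of_mem_ker {P F : Contramodule R} {p : P ⟶ F}
    (hp : ∀ f : P ⟶ P, f ≫ p = p → IsIso f) {σ : P.A → FormalSum R P.A}
    (hσ : ∀ u, σ (act P u) = FormalSum.bind u σ) {k : P.A} (hk : fn p k = 0) (x : P.A) (b : R) :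
    ∃ c, (1 - (σ k).1 x * b) * c = (σ k).1 x := by
  classical
  have hpk : fn p (b • k) = 0 := by rw [fn_smul, hk, smul_zero]
  let δ : P.A → P.A := fun y => if y = x then b • k else 0
  let g : P ⟶ P := mkHom (fun q => act P (FormalSum.map δ (σ q))) fun u => by
    rw [hσ, FormalSum.map_bind, act_map_act]
  have hg : ∀ q, fn g q = (σ q).1 x • b • k := fun q => act_map_ite P x (b • k) (σ q)
  have hgp : g ≫ p = 0 := hom_ext fun q => by
    rw [fn_comp, hg, fn_smul, hpk, smul_zero, fn_zero]
  have : IsIso (𝟙 P - g) := hp _ (by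
    rw [Preadditive.sub_comp, hgp, Category.id_comp, sub_zero])
  have h1 : fn (𝟙 P - g) k = (1 - (σ k).1 x * b) • k := by
    rw [sub_eq_add_neg, fn_add, fn_neg, fn_id, hg, ← sub_eq_add_neg, sub_smul, one_smul, mul_smul]
  have h2 : (1 - (σ k).1 x * b) • fn (inv (𝟙 P - g)) k = k := by
    rw [← fn_smul, ← h1, ← fn_comp, IsIso.hom_inv_id, fn_id]
  refine ⟨(σ (fn (inv (𝟙 P - g)) k)).1 x, ?_⟩
  have h3 := section_smul hσ (1 - (σ k).1 x * b) (fn (inv (𝟙 P - g)) k)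
  rw [h2] at h3
  exact (congrArg (fun w => w.1 x) h3).symm

end Covers

/-! ### Vanishing of elements of contratensor products -/

section ContratensorVanishing

open scoped TensorProduct

variable {N : Type u} [AddCommGroup N] [Module Rᵐᵒᵖ N] [IsDiscreteModule R N]

/-- In `N ⊙ P` the element `n ⊗ ∑ r_p p` is equal to `∑ n r_p ⊗ p`, so it vanishes if all `r_p`
annihilate `n`. -/
theorem mk_tmul_act_eq_zero (P : Contramodule R) (n : N) (u : FormalSum R P.A)
    (h : ∀ x, MulOpposite.op (u.1 x) • n = 0) :
    (QuotientAddGroup.mk (n ⊗ₜ[ℤ] act P u) : ContratensorProduct N P) = 0 := by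
  refine (QuotientAddGroup.eq_zero_iff _).mpr ⟨n ⊗ₜ u, ?_⟩
  have h0 : coeff n u = 0 := by
    ext x
    exact h x
  rw [AddMonoidHom.sub_apply, contraMap_tmul, discreteMap_tmul, h0, Finsupp.sum_zero_index,
    sub_zero]

/-- Opening of parentheses followed by the right action on `n ∈ N` is a finite sum, because all but
finitely many coefficients of `u` annihilate `n`. -/
theorem op_bind_smul {X Y : Type u} (n : N) (u : FormalSum R X) (k : X → FormalSum R Y) (z : Y) :
    MulOpposite.op ((FormalSum.bind u k).1 z) • n =
      (coeff n u).sum fun x m => MulOpposite.op ((k x).1 z) • m := by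
  have h2 : (∑' x, u.1 x * (k x).1 z) - ∑ x ∈ (coeff n u).support, u.1 x * (k x).1 z ∈ ann n := by
    rw [← (u.summable_mul fun x => (k x).1 z).sum_add_tsum_compl (s := (coeff n u).support),
      add_sub_cancel_left]
    refine tsum_mem _ (isOpen_ann n) fun x => mul_mem _ ?_ _
    by_contra h
    exact x.2 (Finset.mem_coe.mpr (Finsupp.mem_support_iff.mpr h))
  rw [mem_ann, MulOpposite.op_sub, sub_smul, sub_eq_zero] at h2
  refine h2.trans ?_
  rw [← MulOpposite.opAddEquiv_apply, map_sum, Finset.sum_smul]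
  refine Finset.sum_congr rfl fun x _ => ?_
  rw [MulOpposite.opAddEquiv_apply, MulOpposite.op_mul, mul_smul]
  rfl

/-- The map `n ⊗ y ↦ n y_z`, where `y_z` is the coordinate of `y` at `z`, is well defined on
`N ⊙ K`. Hence the coordinates of `y` annihilate `n` as soon as `n ⊗ y` vanishes. -/
theorem op_section_smul_eq_zero {K : Contramodule R}
    {σ : K.A → FormalSum R K.A} (hσ : ∀ u, σ (act K u) = FormalSum.bind u σ) {n : N} {y : K.A}
    (h : (QuotientAddGroup.mk (n ⊗ₜ[ℤ] y) : ContratensorProduct N K) = 0) (z : K.A) :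
    MulOpposite.op ((σ y).1 z) • n = 0 := by
  have hadd : ∀ c d, σ (c + d) = σ c + σ d := fun c d => by
    refine (hσ _).trans ?_
    rw [FormalSum.bind_add, FormalSum.pure_bind, FormalSum.pure_bind]
  let ev : N ⊗[ℤ] K.A →+ N := TensorProduct.liftAddHom
    (AddMonoidHom.mk' (fun m => AddMonoidHom.mk' (fun c => MulOpposite.op ((σ c).1 z) • m)
        fun c d => by
          rw [hadd, ← add_smul]
          rfl)
      fun m m' => AddMonoidHom.ext fun c => smul_add _ _ _)
    fun r m c => by
      rw [map_zsmul, map_zsmul]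
      rfl
  have hev : ∀ m c, ev (m ⊗ₜ c) = MulOpposite.op ((σ c).1 z) • m := fun _ _ => rfl
  obtain ⟨t, ht⟩ := (QuotientAddGroup.eq_zero_iff _).mp h
  rw [← hev, ← ht]
  clear ht
  induction t with
  | zero => rw [map_zero, map_zero]
  | add s t hs ht => rw [map_add, map_add, hs, ht, add_zero]
  | tmul m u =>
    rw [AddMonoidHom.sub_apply, map_sub, sub_eq_zero, contraMap_tmul, discreteMap_tmul, hev, hσ,
      op_bind_smul, map_finsuppSum]
    rfl

end ContratensorVanishing

end Contra

/-! ### Projectivity of the covered contramodule -/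

theorem mainTheorem1 {R : Type u} [Ring R] [UniformSpace R] [IsUniformAddGroup R]
    [IsTopologicalRing R] [IsLinearTopology Rᵐᵒᵖ R] [T2Space R] [CompleteSpace R]
    (F : Contra.Contramodule R) (hflat : Contra.IsInftyStrictlyFlat F)
    (hpd : HasProjectiveDimensionLE F 1) (hcover : Contra.HasProjectiveCover F) :
    Projective F := by
  obtain ⟨P, p, ⟨hP, hfac⟩, hp⟩ := hcover
  have hPp : Projective P := hP
  have : Epi p := by
    obtain ⟨f, hf⟩ := hfac _ (Projective.π F) (Projective.projective_over F)
    exact epi_of_epi_fac hf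
  let ι := Contra.kerHom p
  let S : ShortComplex (Contra.Contramodule R) :=
    ShortComplex.mk ι p (Contra.kerHom_comp p)
  have hker := (Contra.kerHom_isKernel p).some
  have hS : S.ShortExact :=
    { exact := ShortComplex.exact_of_f_is_kernel S hker
      mono_f := mono_of_isLimit_fork hker
      epi_g := ‹Epi p› }
  have hK : Projective S.X₁ := projective_iff_hasProjectiveDimensionLT_one.mpr
    ((hS.hasProjectiveDimensionLT_X₃_iff 0 hPp).mp hpd)
  obtain ⟨σ, hσ, hσ'⟩ := Contra.exists_section_of_projective P
  obtain ⟨τ, hτ, hτ'⟩ := Contra.exists_section_of_projective S.X₁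
  -- The coordinates of `ι k` kill every simple discrete `N`, so that `n ⊗ ι k = 0` in `N ⊙ P`;
  -- by flatness `n ⊗ k = 0` already in `N ⊙ K`, and Nakayama's lemma applies to the matrix `τ`.
  have hzero : ∀ y : S.X₁.A, y = 0 := fun y => by
    rw [← hτ y, Contra.eq_zero_of_row_fixed (τ y) τ (by rw [← hτ', hτ])]
    · exact Contra.act_zero _
    intro N _ _ _ _ n k z
    refine Contra.op_section_smul_eq_zero hτ' ?_ z
    have hmono : Mono ((Contra.contratensor N).map S.f) :=
      mono_map_of_isZero_leftDerived_one _ hS (hflat 1 le_rfl N 1 one_pos le_rfl)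
    refine (AddCommGrpCat.mono_iff_injective _).mp hmono ?_
    refine Eq.trans ?_ (map_zero ((Contra.contratensor N).map S.f).hom).symm
    change (QuotientAddGroup.mk (n ⊗ₜ[ℤ] Contra.fn ι k) : Contra.ContratensorProduct N P) = 0
    rw [← hσ (Contra.fn ι k)]
    exact Contra.mk_tmul_act_eq_zero P n _ fun x =>
      Contra.smul_eq_zero_of_right_quasiregular
        (Contra.right_quasiregular_of_mem_ker hp hσ' k.2 x) n
  have hι : S.f = 0 := Contra.hom_ext fun y => by
    rw [hzero y]
    exact (Contra.fnHom S.f).map_zero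
  have : Mono p := hS.exact.mono_g hι
  have : IsIso p := isIso_of_mono_of_epi p
  exact Projective.of_iso (asIso p) hPp
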